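/- A finite set $s\subseteq\mathbb{N}=\{0,1,2,\dots\}$ is called exactly large if it is nonempty and $\operatorname{card}(s)=\min(s)+1$. For $X\subseteq\mathbb{N}$ let $[X]^{!\omega}$ denote the set of exactly large subsets of $X$. A set $Y\subseteq\mathbb{N}$ is homogeneous for a coloring $C\colon[\mathbb{N}]^{!\omega}\to\{0,1\}$ if $C$ is constant on $[Y]^{!\omega}$. Theorem. There exists a computable coloring $C\colon[\mathbb{N}]^{!\omega}\to\{0,1\}$ such that no infinite homogeneous set for $C$ is $\Sigma^0_i$, for any $i\in\mathbb{N}$. (Here $\Sigma^0_i$ denotes the $i$-th level of the arithmetical hierarchy, $\Sigma^0_0$ being the class of computable sets.) -/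

import Mathlib

namespace ExactlyLargeRamsey

/-- A finite set `s` of natural numbers is exactly large if `card s = min s + 1`
(in particular `s` is nonempty). -/
def IsExactlyLarge (s : Finset ℕ) : Prop :=
  ∃ h : s.Nonempty, s.card = s.min' h + 1

/-- A coloring in two colors of the exactly large sets of natural numbers. -/
abbrev Coloring : Type := {s : Finset ℕ // IsExactlyLarge s} → Bool

/-- A coloring is computable if some algorithm, given the increasing enumeration
`[s₀, …, sₘ]` of an exactly large set, returns its color. Being such an enumeration is a
decidable property of lists, so it makes no difference that the algorithm is total on lists. -/
def Coloring.IsComputable (C : Coloring) : Prop :=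
  ∃ f : List ℕ → Bool, Computable f ∧ ∀ s, C s = f (s.1.sort (· ≤ ·))

/-- `Y` is homogeneous for `C` if all exactly large subsets of `Y` have the same color. -/
def Coloring.IsHomogeneous (C : Coloring) (Y : Set ℕ) : Prop :=
  ∃ c : Bool, ∀ s, (↑s.1 : Set ℕ) ⊆ Y → C s = c

/-- The levels `Σ⁰ₙ` of the arithmetical hierarchy: `Σ⁰₀` consists of the computable predicates,
and `Σ⁰ₙ₊₁` of the predicates `∃ y, q (x, y)` where `q` is `Π⁰ₙ`, i.e. `¬ q` is `Σ⁰ₙ`. -/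
def IsSigma : ℕ → ∀ {α : Type} [Primcodable α], (α → Prop) → Prop
  | 0, _, _, p => ComputablePred p
  | n + 1, α, _, p =>
      ∃ q : α × ℕ → Prop, IsSigma n (fun z => ¬ q z) ∧ ∀ x, p x ↔ ∃ y, q (x, y)

end ExactlyLargeRamsey

/-!
The coloring compares two bounded approximations of the truth of arithmetical formulas. Given an
exactly large set `{m < s₁ < ⋯ < sₘ}`, evaluate prenex formulas with at most `m / 2` quantifiers and
parameters below `m`, bounding the successive quantifiers once by `s₁, s₂, …` and once by the
elements that follow the first `m / 2` of them. The color tells whether all these truth values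
agree (`Agree`); it is even primitive recursive (`primrecPred_agree`).

Let `Y` be an infinite homogeneous set. For a fixed `m ∈ Y` there are only finitely many patterns of
truth values, so two of infinitely many successive blocks of elements of `Y` give the same pattern.
Hence the color of `Y` is "agree" (`of_forall_agree_iff`). It follows that, for `m ∈ Y`, the
increasing sequences in `Y` above `m` are indiscernible as quantifier bounds for parameters below
`m` (`IsAgreeing.boundedTruth_eq`). Since the bounds may be taken as sparse as desired, induction
on the number of quantifiers shows that bounded truth is truth (`IsAgreeing.truth_iff`).

Consequently the truth of `Σ⁰ₙ` formulas, as a predicate of `n` and of the formula, is definable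
from membership in `Y` by a formula whose complexity does not depend on `n`
(`IsAgreeing.truth_iff_exists`). If `Y` were `Σ⁰ᵢ`, this predicate would be arithmetical, which a
diagonal argument excludes (`not_isArithmetical_truth`).
-/

namespace ExactlyLargeRamsey

open Nat.Partrec (Code)
open Encodable Denumerable

/-! ### Closure properties of the arithmetical hierarchy -/

section Hierarchy

variable {α β : Type} [Primcodable α] [Primcodable β]

theorem IsSigma.of_iff {i : ℕ} {p q : α → Prop} (hp : IsSigma i p) (h : ∀ x, p x ↔ q x) :
    IsSigma i q := by
  obtain rfl : p = q := funext fun x => propext (h x)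
  exact hp

theorem IsSigma.comp {i : ℕ} : ∀ {α β : Type} [Primcodable α] [Primcodable β] {p : β → Prop}
    {g : α → β}, IsSigma i p → Computable g → IsSigma i fun x => p (g x) := by
  induction i with
  | zero =>
    rintro α β _ _ p g ⟨_, hp⟩ hg
    exact ⟨fun x => inferInstance, hp.comp hg⟩
  | succ i ih =>
    rintro α β _ _ p g ⟨q, hq, hpq⟩ hg
    exact ⟨fun z => q (g z.1, z.2), ih (p := fun z => ¬ q z) hq ((hg.comp .fst).pair .snd),
      fun x => hpq (g x)⟩

theorem IsSigma.not_succ {i : ℕ} {p : α → Prop} (hp : IsSigma i p) :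
    IsSigma (i + 1) fun x => ¬ p x :=
  ⟨fun z => ¬ p z.1, (hp.comp Computable.fst).of_iff fun _ => not_not.symm, fun _ => by simp⟩

theorem IsSigma.succ {i : ℕ} : ∀ {α : Type} [Primcodable α] {p : α → Prop},
    IsSigma i p → IsSigma (i + 1) p := by
  induction i with
  | zero =>
    intro α _ p hp
    exact (IsSigma.not_succ (i := 0) (ComputablePred.not hp)).of_iff fun _ => not_not
  | succ i ih =>
    rintro α _ p ⟨q, hq, hpq⟩
    exact ⟨q, ih hq, hpq⟩

theorem IsSigma.mono {i j : ℕ} {p : α → Prop} (hp : IsSigma i p) (hij : i ≤ j) : IsSigma j p := by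
  induction hij with
  | refl => exact hp
  | step _ ih => exact ih.succ

/-- Conjunction and disjunction have to be treated together, since a negation separates each level
of the hierarchy from the next one. -/
theorem IsSigma.and_or {i : ℕ} : ∀ {α : Type} [Primcodable α] {p q : α → Prop},
    IsSigma i p → IsSigma i q →
      IsSigma i (fun x => p x ∧ q x) ∧ IsSigma i (fun x => p x ∨ q x) := by
  induction i with
  | zero =>
    rintro α _ p q ⟨_, hp⟩ ⟨_, hq⟩
    exact ⟨⟨fun x => inferInstance, (Primrec.and.to_comp.comp hp hq).of_eq fun x => by simp⟩,
      ⟨fun x => inferInstance, (Primrec.or.to_comp.comp hp hq).of_eq fun x => by simp⟩⟩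
  | succ i ih =>
    rintro α _ p q ⟨p', hp', hp⟩ ⟨q', hq', hq⟩
    constructor
    · have hu : Computable fun z : α × ℕ => (z.1, z.2.unpair.1) :=
        Computable.fst.pair (Computable.fst.comp (Computable.unpair.comp .snd))
      have hv : Computable fun z : α × ℕ => (z.1, z.2.unpair.2) :=
        Computable.fst.pair (Computable.snd.comp (Computable.unpair.comp .snd))
      refine ⟨fun z => p' (z.1, z.2.unpair.1) ∧ q' (z.1, z.2.unpair.2),
        (ih (hp'.comp hu) (hq'.comp hv)).2.of_iff fun z => not_and_or.symm, fun x => ?_⟩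
      beta_reduce
      rw [hp, hq]
      constructor
      · rintro ⟨⟨y, hy⟩, y', hy'⟩
        exact ⟨Nat.pair y y', by simpa using ⟨hy, hy'⟩⟩
      · rintro ⟨y, hy, hy'⟩
        exact ⟨⟨_, hy⟩, _, hy'⟩
    · refine ⟨fun z => p' z ∨ q' z, (ih hp' hq').1.of_iff fun z => not_or.symm, fun x => ?_⟩
      beta_reduce
      rw [hp, hq, exists_or]

/-- A predicate is arithmetical if it lies on some level of the arithmetical hierarchy. -/
def IsArithmetical (p : α → Prop) : Prop := ∃ i, IsSigma i p

theorem isArithmetical_of_primrecPred {p : α → Prop} (hp : PrimrecPred p) : IsArithmetical p := by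
  obtain ⟨_, hp⟩ := hp
  exact ⟨0, inferInstance, hp.to_comp⟩

namespace IsArithmetical

theorem of_iff {p q : α → Prop} (hp : IsArithmetical p) (h : ∀ x, p x ↔ q x) :
    IsArithmetical q :=
  hp.imp fun _ hi => hi.of_iff h

theorem comp {p : β → Prop} {g : α → β} (hp : IsArithmetical p) (hg : Primrec g) :
    IsArithmetical fun x => p (g x) :=
  hp.imp fun _ hi => hi.comp hg.to_comp

theorem not {p : α → Prop} (hp : IsArithmetical p) : IsArithmetical fun x => ¬ p x := by
  obtain ⟨i, hi⟩ := hp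
  exact ⟨i + 1, hi.not_succ⟩

theorem and {p q : α → Prop} (hp : IsArithmetical p) (hq : IsArithmetical q) :
    IsArithmetical fun x => p x ∧ q x := by
  obtain ⟨i, hi⟩ := hp
  obtain ⟨j, hj⟩ := hq
  exact ⟨max i j, (IsSigma.and_or (hi.mono (le_max_left i j)) (hj.mono (le_max_right i j))).1⟩

theorem exists_nat {p : α × ℕ → Prop} (hp : IsArithmetical p) :
    IsArithmetical fun x => ∃ y, p (x, y) := by
  obtain ⟨i, hi⟩ := hp
  exact ⟨i + 2, p, hi.not_succ, fun _ => Iff.rfl⟩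

theorem forall_nat {p : α × ℕ → Prop} (hp : IsArithmetical p) :
    IsArithmetical fun x => ∀ y, p (x, y) :=
  hp.not.exists_nat.not.of_iff fun x => by simp

theorem exists_list {p : α × List ℕ → Prop} (hp : IsArithmetical p) :
    IsArithmetical fun x => ∃ l, p (x, l) := by
  have hg : Primrec fun z : α × ℕ => (z.1, ofNat (List ℕ) z.2) :=
    Primrec.fst.pair ((Primrec.ofNat _).comp .snd)
  refine (hp.comp hg).exists_nat.of_iff fun x => ?_
  exact ⟨fun ⟨n, hn⟩ => ⟨_, hn⟩, fun ⟨l, hl⟩ => ⟨encode l, by simpa using hl⟩⟩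

theorem forall_mem_list {p : ℕ → Prop} (hp : IsArithmetical p) :
    IsArithmetical fun l : List ℕ => ∀ a ∈ l, p a := by
  have hlt : PrimrecPred fun z : List ℕ × ℕ => z.2 < z.1.length :=
    Primrec.nat_lt.comp .snd (Primrec.list_length.comp .fst)
  have hget : Primrec fun z : List ℕ × ℕ => z.1.getD z.2 0 :=
    (Primrec.list_getD 0).comp .fst .snd
  refine (((isArithmetical_of_primrecPred hlt).and (hp.comp hget).not).not.forall_nat).of_iff fun l => ?_
  simp only [not_and, not_not, List.forall_mem_iff_getElem]
  refine forall_congr' fun i => forall_congr' fun hi => ?_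
  rw [List.getD_eq_getElem l 0 hi]

end IsArithmetical

end Hierarchy

/-! ### Truth for prenex formulas and a universal enumeration -/

/-- Append the value `y` to the arguments of `z = ⟨e, w⟩`, keeping the program `e`. -/
def extend (z y : ℕ) : ℕ := Nat.pair z.unpair.1 (Nat.pair z.unpair.2 y)

/-- The quantifier-free part of all formulas: at `⟨e, ⟨w, t⟩⟩` it says that the program `e` does
not halt on input `w` within time `t`. -/
def matrix (z : ℕ) : Bool :=
  !(Code.evaln z.unpair.2.unpair.2 (ofNat Code z.unpair.1) z.unpair.2.unpair.1).isSome

/-- `Truth n ⟨e, w⟩` is the truth value of the formula `∃ y₁, ¬ ∃ y₂, ¬ ⋯ ∃ yₙ, ¬ matrix` with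
program `e` and arguments `w, y₁, …, yₙ`. For `n > 0` it is a universal `Σ⁰ₙ` predicate. -/
def Truth : ℕ → ℕ → Prop
  | 0, z => matrix z = true
  | n + 1, z => ∃ y, ¬ Truth n (extend z y)

/-- The same formula as in `Truth`, with as many quantifiers as the list has entries, the entries
of the list being strict bounds for the successive quantifiers. -/
def boundedTruth : List ℕ → ℕ → Bool
  | [], z => matrix z
  | a :: l, z => (List.range a).any fun y => !boundedTruth l (extend z y)

theorem boundedTruth_cons {a : ℕ} {l : List ℕ} {z : ℕ} :
    boundedTruth (a :: l) z = true ↔ ∃ y < a, ¬ boundedTruth l (extend z y) = true := by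
  simp [boundedTruth]

theorem primrec_extend : Primrec₂ extend :=
  Primrec₂.natPair.comp (Primrec.fst.comp (Primrec.unpair.comp .fst))
    (Primrec₂.natPair.comp (Primrec.snd.comp (Primrec.unpair.comp .fst)) .snd)

theorem primrec_matrix : Primrec matrix := by
  have h : Primrec fun z : ℕ => z.unpair.2.unpair :=
    Primrec.unpair.comp (Primrec.snd.comp Primrec.unpair)
  exact Primrec.not.comp (Primrec.option_isSome.comp (Code.primrec_evaln.comp
    (((Primrec.snd.comp h).pair ((Primrec.ofNat Code).comp (Primrec.fst.comp Primrec.unpair))).pair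
      (Primrec.fst.comp h))))

theorem primrec_boundedTruth : Primrec₂ boundedTruth := by
  have hm : Primrec fun p : List ℕ × ℕ => p.1.length := Primrec.list_length.comp .fst
  have hl : Primrec fun p : List ℕ × ℕ =>
      (List.range p.1.headI).map fun y => (p.1.tail, extend p.2 y) :=
    Primrec.list_map (Primrec.list_range.comp (Primrec.list_headI.comp .fst))
      ((Primrec.list_tail.comp (Primrec.fst.comp .fst)).pair
        (primrec_extend.comp (Primrec.snd.comp .fst) .snd))
  have hany : PrimrecPred fun l : List Bool => ∃ b ∈ l, b = false :=
    PrimrecPred.exists_mem_list (Primrec.eq.comp .id (.const false))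
  have hnil : PrimrecPred fun l : List ℕ => l = [] := Primrec.eq.comp .id (.const [])
  have hg : Primrec₂ fun (p : List ℕ × ℕ) (bs : List Bool) =>
      some (if p.1 = [] then matrix p.2 else decide (∃ b ∈ bs, b = false)) := by
    refine Primrec.option_some.comp (Primrec.ite (hnil.comp (Primrec.fst.comp .fst))
      (primrec_matrix.comp (Primrec.snd.comp .fst)) ?_)
    exact (hany.comp Primrec.snd).decide
  refine Primrec.nat_omega_rec' (fun p : List ℕ × ℕ => boundedTruth p.1 p.2) hm hl hg ?_ ?_
  · rintro ⟨l, z⟩ b hb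
    cases l with
    | nil => simp at hb
    | cons a l =>
      obtain ⟨y, -, rfl⟩ := List.mem_map.1 hb
      simp
  · rintro ⟨l, z⟩
    cases l with
    | nil => simp [boundedTruth]
    | cons a l =>
      rw [Option.some_inj, Bool.eq_iff_iff, boundedTruth_cons]
      simp

/-- Every `Σ⁰ₙ₊₁` predicate is a section of `Truth (n + 1)`. -/
theorem IsSigma.exists_truth_iff {n : ℕ} : ∀ {α : Type} [Primcodable α] {p : α → Prop},
    IsSigma (n + 1) p → ∃ e, ∀ x, p x ↔ Truth (n + 1) (Nat.pair e (encode x)) := by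
  induction n with
  | zero =>
    rintro α _ p ⟨q, hq, hpq⟩
    obtain ⟨_, hq⟩ := ComputablePred.not hq
    -- The program searches for a witness of the existential quantifier.
    have hf : Partrec fun x : α => Nat.rfind fun y => Part.some (decide (¬ ¬ q (x, y))) :=
      Partrec.rfind hq
    obtain ⟨c, hc⟩ := Code.exists_code.1 hf
    refine ⟨encode c, fun x => ?_⟩
    have hdom : p x ↔ (Code.eval c (encode x)).Dom := by
      rw [hpq, hc]
      simp only [encodek, Part.coe_some, Part.bind_some, Part.map_Dom]
      refine Iff.symm (Nat.rfind_dom.trans ?_)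
      simp
    rw [hdom, Part.dom_iff_mem]
    simp only [Truth, matrix, extend, Nat.unpair_pair, ofNat_encode, Code.evaln_complete,
      Bool.not_eq_true, Bool.not_eq_false', Option.isSome_iff_exists, Option.mem_def]
    exact exists_comm
  | succ n ih =>
    rintro α _ p ⟨q, hq, hpq⟩
    obtain ⟨e, he⟩ := ih hq
    refine ⟨e, fun x => ?_⟩
    rw [hpq]
    refine exists_congr fun y => ?_
    rw [← not_iff_not, he, not_not, encode_prod_val, extend, Nat.unpair_pair, encode_nat]

/-- A form of Tarski's theorem on the undefinability of truth. -/
theorem not_isArithmetical_truth : ¬ IsArithmetical fun z : ℕ × ℕ => Truth z.1 z.2 := by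
  rintro ⟨i, hi⟩
  have hg : Computable fun e : ℕ => (i + 1, Nat.pair e e) :=
    (Computable.const _).pair (Primrec₂.natPair.comp .id .id).to_comp
  obtain ⟨e, he⟩ := (hi.comp hg).not_succ.exists_truth_iff
  exact iff_not_self (he e).symm

/-! ### The coloring -/

theorem primrecRel_forall_lt {α : Type} [Primcodable α] {R : ℕ → α → Prop} (hR : PrimrecRel R) :
    PrimrecRel fun n x => ∀ i < n, R i x :=
  (hR.forall_mem_list.comp (Primrec.list_range.comp .fst) .snd).of_eq (by simp)

/-- For the increasing enumeration `m :: l` of an exactly large set: the entries of the first half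
of `l` and those of the second half, taken as quantifier bounds, give the same bounded truth values
for all parameters below `m` and all numbers of quantifiers up to `m / 2`. -/
def Agree (m : ℕ) (l : List ℕ) : Prop :=
  ∀ j < m / 2 + 1, ∀ z < m,
    boundedTruth (l.take j) z = boundedTruth ((l.drop (m / 2)).take j) z

theorem primrecPred_agree : PrimrecPred fun w : List ℕ => Agree w.headI w.tail := by
  have hj : Primrec fun p : ℕ × ℕ × List ℕ => p.2.1 := Primrec.fst.comp .snd
  have hw : Primrec fun p : ℕ × ℕ × List ℕ => p.2.2 := Primrec.snd.comp .snd
  have hhalf : Primrec fun w : List ℕ => w.headI / 2 :=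
    Primrec.nat_div.comp Primrec.list_headI (.const 2)
  have h₁ : PrimrecRel fun (z : ℕ) (p : ℕ × List ℕ) => boundedTruth (p.2.tail.take p.1) z =
      boundedTruth ((p.2.tail.drop (p.2.headI / 2)).take p.1) z := by
    refine Primrec.eq.comp (primrec_boundedTruth.comp
      (Primrec.list_take.comp hj (Primrec.list_tail.comp hw)) .fst) ?_
    exact primrec_boundedTruth.comp (Primrec.list_take.comp hj
      (Primrec.list_drop.comp (hhalf.comp hw) (Primrec.list_tail.comp hw))) .fst
  have h₂ : PrimrecRel fun (j : ℕ) (w : List ℕ) => ∀ z < w.headI,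
      boundedTruth (w.tail.take j) z =
        boundedTruth ((w.tail.drop (w.headI / 2)).take j) z :=
    (primrecRel_forall_lt h₁).comp (Primrec.list_headI.comp .snd) .id
  exact (primrecRel_forall_lt h₂).comp (Primrec.succ.comp hhalf) .id

open Classical in
/-- The coloring of an exactly large set according to `Agree`. -/
noncomputable def agreeColoring : Coloring := fun s =>
  decide (Agree (s.1.sort (· ≤ ·)).headI (s.1.sort (· ≤ ·)).tail)

theorem agreeColoring_isComputable : agreeColoring.IsComputable := by
  classical
  exact ⟨fun w => decide (Agree w.headI w.tail), primrecPred_agree.decide.to_comp, fun s => rfl⟩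

/-! ### Homogeneous sets -/

/-- `l` is a strictly increasing list of elements of `Y` that lie above `m`. -/
def IsChainAbove (Y : Set ℕ) (m : ℕ) (l : List ℕ) : Prop :=
  (m :: l).Pairwise (· < ·) ∧ ∀ a ∈ l, a ∈ Y

/-- In `Y`, the chains of length `m` above any of its elements `m` satisfy `Agree`. -/
def IsAgreeing (Y : Set ℕ) : Prop :=
  ∀ m ∈ Y, ∀ l, IsChainAbove Y m l → l.length = m → Agree m l

section Chains

variable {Y : Set ℕ} {m : ℕ}

theorem isChainAbove_cons {a : ℕ} {l : List ℕ} :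
    IsChainAbove Y m (a :: l) ↔ m < a ∧ a ∈ Y ∧ IsChainAbove Y a l := by
  simp only [IsChainAbove, List.pairwise_cons, List.forall_mem_cons]
  constructor
  · rintro ⟨⟨⟨h₁, -⟩, h₂⟩, h₃, h₄⟩
    exact ⟨h₁, h₃, h₂, h₄⟩
  · rintro ⟨h₁, h₃, h₂, h₄⟩
    exact ⟨⟨⟨h₁, fun b hb => h₁.trans (h₂.1 b hb)⟩, h₂⟩, h₃, h₄⟩

theorem IsChainAbove.mono {m' : ℕ} {l : List ℕ} (h : IsChainAbove Y m l) (hm : m' ≤ m) :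
    IsChainAbove Y m' l := by
  simp only [IsChainAbove, List.pairwise_cons] at h ⊢
  exact ⟨⟨fun b hb => hm.trans_lt (h.1.1 b hb), h.1.2⟩, h.2⟩

theorem IsChainAbove.append {M : ℕ} {l l' : List ℕ} (h : IsChainAbove Y m l)
    (h' : IsChainAbove Y M l') (hm : m ≤ M) (hl : ∀ a ∈ l, a ≤ M) :
    IsChainAbove Y m (l ++ l') := by
  induction l generalizing m with
  | nil => exact h'.mono hm
  | cons a l ih =>
    rw [List.cons_append, isChainAbove_cons]
    rw [isChainAbove_cons] at h
    exact ⟨h.1, h.2.1, ih h.2.2 (hl a (by simp)) fun b hb => hl b (by simp [hb])⟩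

theorem exists_isChainAbove (hY : Y.Infinite) (m n : ℕ) :
    ∃ l, IsChainAbove Y m l ∧ l.length = n := by
  induction n generalizing m with
  | zero => exact ⟨[], by simp [IsChainAbove], rfl⟩
  | succ n ih =>
    obtain ⟨a, ha, hma⟩ := hY.exists_gt m
    obtain ⟨l, hl, rfl⟩ := ih a
    exact ⟨a :: l, isChainAbove_cons.2 ⟨hma, ha, hl⟩, rfl⟩

theorem exists_upper_bound (m : ℕ) (l : List ℕ) : ∃ M, m ≤ M ∧ ∀ a ∈ l, a ≤ M :=
  ⟨m + l.sum, by omega, fun a ha => (List.le_sum_of_mem ha).trans (by omega)⟩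

/-- If the lists `m :: l` with `l` a chain of length `m` either all satisfy `Agree` or all fail it,
then they all satisfy it: for a given `m` there are only finitely many patterns of bounded truth
values, so among infinitely many successive chains two have the same pattern. -/
theorem of_forall_agree_iff (hY : Y.Infinite) {c : Prop}
    (hc : ∀ m ∈ Y, ∀ l, IsChainAbove Y m l → l.length = m → (Agree m l ↔ c)) : c := by
  obtain ⟨m, hm⟩ := hY.nonempty
  choose next hnext hlen using fun M => exists_isChainAbove hY M m
  choose top htop hle using fun M => exists_upper_bound M (next M)
  -- `M i` is the lower bound of the `i`-th block `next (M i)`.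
  let M : ℕ → ℕ := fun i => Nat.rec m (fun _ M => top M) i
  have hM : Monotone M := monotone_nat_of_le_succ fun i => htop (M i)
  let pattern : ℕ → Fin (m / 2 + 1) → Fin m → Bool :=
    fun i j z => boundedTruth ((next (M i)).take j) z
  obtain ⟨i, i', hne, hp⟩ := Finite.exists_ne_map_eq_of_infinite pattern
  wlog hlt : i < i' generalizing i i'
  · exact this i' i hne.symm hp.symm (by omega)
  have htake : IsChainAbove Y (M i) ((next (M i)).take (m / 2)) :=
    ⟨(hnext (M i)).1.sublist (by simp [List.take_sublist]),
      fun a ha => (hnext (M i)).2 a (List.mem_of_mem_take ha)⟩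
  have htake' : IsChainAbove Y (M i') ((next (M i')).take (m - m / 2)) :=
    ⟨(hnext (M i')).1.sublist (by simp [List.take_sublist]),
      fun a ha => (hnext (M i')).2 a (List.mem_of_mem_take ha)⟩
  have hchain := (htake.append htake' (hM hlt.le) fun a ha =>
    (hle (M i) a (List.mem_of_mem_take ha)).trans (hM hlt)).mono (hM (Nat.zero_le i))
  refine (hc m hm _ hchain (by simp [hlen]; omega)).1 fun j hj z hz => ?_
  have hdrop : ((next (M i)).take (m / 2)).length = m / 2 := by simp [hlen]; omega
  rw [List.drop_left' hdrop, List.take_append_of_le_length (by omega), List.take_take,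
    List.take_take, min_eq_left (by omega), min_eq_left (by omega)]
  exact congrFun (congrFun hp ⟨j, hj⟩) ⟨z, hz⟩

theorem Coloring.IsHomogeneous.isAgreeing (h : agreeColoring.IsHomogeneous Y) (hY : Y.Infinite) :
    IsAgreeing Y := by
  obtain ⟨c, hc⟩ := h
  have key : ∀ m ∈ Y, ∀ l, IsChainAbove Y m l → l.length = m → (Agree m l ↔ c = true) := by
    intro m hm l hl hlen
    have hnd : (m :: l).Nodup := hl.1.imp fun h => h.ne
    have hsort : (m :: l).toFinset.sort (· ≤ ·) = m :: l :=
      (List.toFinset_sort (· ≤ ·) hnd).2 (hl.1.imp fun h => h.le)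
    have hmin : ∀ a ∈ m :: l, m ≤ a := by
      simpa using fun a ha => ((List.pairwise_cons.1 hl.1).1 a ha).le
    have hs : IsExactlyLarge (m :: l).toFinset := by
      refine ⟨⟨m, by simp⟩, ?_⟩
      rw [List.toFinset_card_of_nodup hnd, List.length_cons, hlen]
      congr 1
      refine le_antisymm (Finset.le_min' _ _ _ fun a ha => hmin a (List.mem_toFinset.1 ha))
        (Finset.min'_le _ _ (by simp))
    have hcs := hc ⟨_, hs⟩ (by
      intro a ha
      simp only [List.coe_toFinset, Set.mem_ofPred_eq, List.mem_cons] at ha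
      rcases ha with rfl | ha
      exacts [hm, hl.2 a ha])
    rw [← hcs]
    simp only [agreeColoring, decide_eq_true_iff, hsort, List.headI_cons, List.tail_cons]
  exact fun m hm l hl hlen => (key m hm l hl hlen).2 (of_forall_agree_iff hY key)

end Chains

namespace IsAgreeing

variable {Y : Set ℕ} {m : ℕ}

/-- Chains above `m` of the same length are indiscernible by parameters below `m`: both can be
compared with the second half of one chain that lies above them. -/
theorem boundedTruth_eq (hagree : IsAgreeing Y) (hY : Y.Infinite) (hm : m ∈ Y) {z : ℕ} (hz : z < m)
    {a b : List ℕ} (ha : IsChainAbove Y m a) (hb : IsChainAbove Y m b) (hlen : a.length = b.length)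
    (hj : a.length ≤ m / 2) : boundedTruth a z = boundedTruth b z := by
  obtain ⟨M, hM, hle⟩ := exists_upper_bound m (a ++ b)
  obtain ⟨d, hd, hdlen⟩ := exists_isChainAbove hY M (m - a.length)
  have key : ∀ x : List ℕ, IsChainAbove Y m x → (∀ y ∈ x, y ≤ M) → x.length = a.length →
      boundedTruth x z = boundedTruth ((d.drop (m / 2 - a.length)).take a.length) z := by
    intro x hx hxM hxlen
    have h := hagree m hm _ (hx.append hd hM hxM) (by simp [hdlen]; omega) a.length (by omega) z hz
    rwa [List.take_left' hxlen, List.drop_append, List.drop_eq_nil_of_le (by omega),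
      List.nil_append, hxlen] at h
  rw [key a ha (fun x hx => hle x (by simp [hx])) rfl,
    key b hb (fun x hx => hle x (by simp [hx])) hlen.symm]

/-- For parameters below `m`, the entries of a chain above `m` are correct quantifier bounds. -/
theorem truth_iff (hagree : IsAgreeing Y) (hY : Y.Infinite) {n : ℕ} (hm : m ∈ Y) {z : ℕ}
    (hz : z < m) {a : List ℕ} (ha : IsChainAbove Y m a) (hlen : a.length = n) (hn : n ≤ m / 2) :
    Truth n z ↔ boundedTruth a z = true := by
  induction n generalizing m z a with
  | zero =>
    obtain rfl := List.eq_nil_of_length_eq_zero hlen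
    rfl
  | succ n ih =>
    constructor
    · rintro ⟨y, hy⟩
      -- By indiscernibility the first bound may be taken beyond the witness `y`.
      obtain ⟨a₁, ha₁, hlt⟩ := hY.exists_gt (m + y + extend z y)
      obtain ⟨a', ha', hlen'⟩ := exists_isChainAbove hY a₁ n
      rw [hagree.boundedTruth_eq hY hm hz ha (isChainAbove_cons.2 ⟨by omega, ha₁, ha'⟩)
        (by simp [hlen, hlen']) (by omega), boundedTruth_cons]
      exact ⟨y, by omega, by rwa [← ih ha₁ (by omega) ha' hlen' (by omega)]⟩
    · intro h
      -- By indiscernibility the bounds after the first one, `a₁`, may be taken beyond an element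
      -- `a₂` that exceeds all parameters `extend z y` with `y < a₁`.
      obtain ⟨a₁, ha₁, hlt⟩ := hY.exists_gt m
      obtain ⟨M, hM, hle⟩ := exists_upper_bound a₁ ((List.range a₁).map (extend z))
      obtain ⟨a₂, ha₂, hlt₂⟩ := hY.exists_gt M
      obtain ⟨a', ha', hlen'⟩ := exists_isChainAbove hY a₂ n
      rw [hagree.boundedTruth_eq hY hm hz ha
        (isChainAbove_cons.2 ⟨hlt, ha₁, ha'.mono (by omega)⟩)
        (by simp [hlen, hlen']) (by omega), boundedTruth_cons] at h
      obtain ⟨y, hy, hb⟩ := h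
      have hey : extend z y ≤ M := hle _ (List.mem_map_of_mem (List.mem_range.2 hy))
      exact ⟨y, by rwa [ih ha₂ (by omega) ha' hlen' (by omega)]⟩

/-- Truth is defined uniformly in `n` by one formula in which `Y` occurs as a predicate: `w` lists
an element `m` of `Y` and a chain of length `n` above it. -/
theorem truth_iff_exists (hagree : IsAgreeing Y) (hY : Y.Infinite) (n z : ℕ) :
    Truth n z ↔ ∃ w : List ℕ, (∀ a ∈ w, a ∈ Y) ∧
      (∀ j < w.length, ∀ i < j, w.getD i 0 < w.getD j 0) ∧
      2 * n ≤ w.headI ∧ z < w.headI ∧ w.length = n + 1 ∧ boundedTruth w.tail z = true := by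
  have hpw : ∀ w : List ℕ, (∀ j < w.length, ∀ i < j, w.getD i 0 < w.getD j 0) ↔
      w.Pairwise (· < ·) := by
    intro w
    rw [List.pairwise_iff_getElem]
    constructor
    · intro h i j hi hj hij
      simpa [hi, hj] using h j hj i hij
    · intro h j hj i hij
      simpa [hij.trans hj, hj] using h i j (hij.trans hj) hj hij
  simp only [hpw]
  constructor
  · intro h
    obtain ⟨m, hm, hlt⟩ := hY.exists_gt (2 * n + z)
    obtain ⟨l, hl, hlen⟩ := exists_isChainAbove hY m n
    refine ⟨m :: l, List.forall_mem_cons.2 ⟨hm, hl.2⟩, hl.1, ?_, ?_, by simp [hlen], ?_⟩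
    · simp only [List.headI_cons]; omega
    · simp only [List.headI_cons]; omega
    · exact (hagree.truth_iff hY hm (by omega) hl hlen (by omega)).1 h
  · rintro ⟨w, hw, hinc, hn, hz, hlen, hb⟩
    cases w with
    | nil => simp at hlen
    | cons m l =>
      rw [List.forall_mem_cons] at hw
      simp only [List.headI_cons, List.tail_cons, List.length_cons, Nat.add_right_cancel_iff]
        at hn hz hlen hb
      exact (hagree.truth_iff hY hw.1 hz ⟨hinc, hw.2⟩ hlen (by omega)).2 hb

theorem not_isArithmetical (hagree : IsAgreeing Y) (hY : Y.Infinite) :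
    ¬ IsArithmetical fun x : ℕ => x ∈ Y := by
  intro hYa
  refine not_isArithmetical_truth ?_
  have hinc : PrimrecPred fun w : List ℕ =>
      ∀ j < w.length, ∀ i < j, w.getD i 0 < w.getD j 0 := by
    have h₁ : PrimrecRel fun (i : ℕ) (p : ℕ × List ℕ) => p.2.getD i 0 < p.2.getD p.1 0 :=
      Primrec.nat_lt.comp ((Primrec.list_getD 0).comp (Primrec.snd.comp .snd) .fst)
        ((Primrec.list_getD 0).comp (Primrec.snd.comp .snd) (Primrec.fst.comp .snd))
    have h₂ : PrimrecRel fun (j : ℕ) (w : List ℕ) => ∀ i < j, w.getD i 0 < w.getD j 0 :=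
      (primrecRel_forall_lt h₁).comp .fst .id
    exact (primrecRel_forall_lt h₂).comp Primrec.list_length .id
  have hn : Primrec fun p : (ℕ × ℕ) × List ℕ => p.1.1 := Primrec.fst.comp .fst
  have hz : Primrec fun p : (ℕ × ℕ) × List ℕ => p.1.2 := Primrec.snd.comp .fst
  have hhead : Primrec fun p : (ℕ × ℕ) × List ℕ => p.2.headI := Primrec.list_headI.comp .snd
  have hb : PrimrecPred fun p : (ℕ × ℕ) × List ℕ => boundedTruth p.2.tail p.1.2 = true :=
    Primrec.eq.comp (primrec_boundedTruth.comp (Primrec.list_tail.comp .snd) hz) (.const true)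
  have hp : PrimrecPred fun p : (ℕ × ℕ) × List ℕ =>
      (∀ j < p.2.length, ∀ i < j, p.2.getD i 0 < p.2.getD j 0) ∧ 2 * p.1.1 ≤ p.2.headI ∧
        p.1.2 < p.2.headI ∧ p.2.length = p.1.1 + 1 ∧ boundedTruth p.2.tail p.1.2 = true :=
    (hinc.comp .snd).and ((Primrec.nat_le.comp (Primrec.nat_mul.comp (.const 2) hn) hhead).and
      ((Primrec.nat_lt.comp hz hhead).and
        ((Primrec.eq.comp (Primrec.list_length.comp .snd) (Primrec.succ.comp hn)).and hb)))
  refine ((hYa.forall_mem_list.comp Primrec.snd).and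
    (isArithmetical_of_primrecPred hp)).exists_list.of_iff fun z => ?_
  exact (hagree.truth_iff_exists hY z.1 z.2).symm

end IsAgreeing

end ExactlyLargeRamsey

theorem mainTheorem3 :
    ∃ C : ExactlyLargeRamsey.Coloring, C.IsComputable ∧
      ∀ Y : Set ℕ, Y.Infinite → C.IsHomogeneous Y →
        ∀ i : ℕ, ¬ ExactlyLargeRamsey.IsSigma i (fun x : ℕ => x ∈ Y) :=
  ⟨ExactlyLargeRamsey.agreeColoring, ExactlyLargeRamsey.agreeColoring_isComputable,
    fun _ hY hC i hi => (hC.isAgreeing hY).not_isArithmetical hY ⟨i, hi⟩⟩
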